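/- Let $N\ge 1$ and $\ell\ge 0$, let $\lambda=(\lambda_1\ge\dots\ge\lambda_\ell\ge 0)$ and $\mu=(\mu_1\ge\dots\ge\mu_\ell\ge 0)$ be partitions of the same length $\ell=\ell(\lambda)=\ell(\mu)$ (trailing zeroes allowed and counted), put $\rho=(\ell-1,\ell-2,\dots,0)$, and let $M\ge 0$ be an integer with $M\ge\max(\lambda_1,\mu_1)+\ell-1$ if $\ell\ge1$. Let $x_i,y_i,A_i,B_i$ ($1\le i\le N$) be elements of a commutative ring $R$. *The models.* Consider the rectangular grid with $N$ rows and $M+1$ columns, the columns being labelled $0,\dots,M$ from left to right. A state assigns a spin $+$ or $-$ to every edge, subject to the boundary conditions below; its weight is the product over all vertices of the Boltzmann weights, and the partition function $Z$ is the sum of the weights of all states. We list the spins around a vertex in the order (left, top, right, bottom); configurations not listed have weight $0$. In $\mathfrak S_{\lambda+\rho/\mu+\rho}$ the rows are labelled $1,\dots,N$ from bottom to top, all left and right boundary edges are $+$, the bottom boundary edge in column $j$ is $-$ if $j$ is a part of $\lambda+\rho$ and $+$ otherwise, and the top boundary edge in column $j$ is $-$ if $j$ is a part of $\mu+\rho$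 and $+$ otherwise. The weights in row $i$ are $$(++++)\mapsto A_i,\quad (----)\mapsto y_iA_iB_i,\quad (+-+-)\mapsto A_iB_i,$$ $$(-+-+)\mapsto x_iA_i,\quad (-++-)\mapsto (x_i+y_i)A_iB_i,\quad (+--+)\mapsto A_i.$$ In $\mathfrak S^*_{\lambda+\rho/\mu+\rho}$, where the $A_i,B_i$ are assumed invertible, the rows are labelled $1,\dots,N$ from top to bottom, all left and right boundary edges are $+$, the top boundary edges are $-$ exactly in the columns that are parts of $\lambda+\rho$, and the bottom boundary edges are $-$ exactly in the columns that are parts of $\mu+\rho$. The weights in row $i$ are $$(++++)\mapsto A_i^{-1},\quad (----)\mapsto x_iA_i^{-1}B_i^{-1},\quad (+-+-)\mapsto A_i^{-1}B_i^{-1},$$ $$(-+-+)\mapsto y_iA_i^{-1},\quad (++--)\mapsto (x_i+y_i)A_i^{-1},\quad (--++)\mapsto A_i^{-1}B_i^{-1}.$$ *Supersymmetric Schur functions.* For indeterminates $x_1,\dots,x_N,y_1,\dots,y_N$, with $y_k:=0$ for $k>N$, put $[t|\boldsymbol y]^r=(t+y_1)\cdots(t+y_r)$ and, for integers $e_1,\dots,e_N\ge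 0$, $\mathcal A_{e}=\det_{1\le i,j\le N}\big([x_i|\boldsymbol y]^{e_j}\big)$. For an integer $r\ge0$ let $$h_r[\boldsymbol x|\boldsymbol y]=\frac{\mathcal A_{(r+N-1,\,N-2,\,\dots,\,1,\,0)}}{\mathcal A_{(N-1,\,N-2,\,\dots,\,1,\,0)}}\in\mathbb Z[\boldsymbol x,\boldsymbol y],$$ and let $h_r[\boldsymbol x|\boldsymbol y]=0$ for $r<0$. The skew supersymmetric Schur function is the polynomial $$s_{\lambda/\mu}[\boldsymbol x|\boldsymbol y]=\det_{1\le i,j\le\ell} h_{\lambda_i-\mu_j-i+j}[\boldsymbol x|\boldsymbol y],$$ which may be evaluated at elements of $R$. *Claim.* For all $x_i,y_i,A_i,B_i\in R$, $$Z(\mathfrak S_{\lambda+\rho/\mu+\rho})=\prod_{i=1}^N A_i^{M+1}B_i^{\ell}\cdot s_{\lambda/\mu}[x_1,\dots,x_N|y_1,\dots,y_N],$$ and, if all $A_i$ and $B_i$ are invertible, $$Z(\mathfrak S^*_{\lambda+\rho/\mu+\rho})=\prod_{i=1}^N A_i^{-(M+1)}B_i^{-\ell}\cdot s_{\lambda/\mu}[y_1,\dots,y_N|x_1,\dots,x_N].$$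 -/

import Mathlib

namespace SixVertex

/-! ### Partitions -/

/-- The `ρ`-shift of a sequence of length `n`:
`lam + ρ = (lam₁ + (n-1), lam₂ + (n-2), …, lamₙ)`. The index set `Fin n` starts at `0`. -/
def rhoShift {n : ℕ} (lam : Fin n → ℕ) : Fin n → ℕ :=
  fun i => lam i + (n - 1 - (i : ℕ))

/-! ### Six-vertex lattice models -/

/-- The two spins. -/
inductive Spin where
  | plus
  | minus
deriving DecidableEq

instance : Fintype Spin where
  elems := {Spin.plus, Spin.minus}
  complete := fun s => by cases s <;> simp

/-- An assignment of spins to all edges of a grid with `N` rows and `M + 1` columns. Rows are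
numbered here by their geometric position from bottom to top, columns from left to right.
`s.1 k j` is the horizontal edge of row `k` immediately to the left of column `j` (for `j = M + 1`:
the right boundary edge); `s.2 k j` is the vertical edge of column `j` immediately below row `k`
(for `k = N`: the top boundary edge). -/
abbrev State (N M : ℕ) : Type :=
  (Fin N → Fin (M + 2) → Spin) × (Fin (N + 1) → Fin (M + 1) → Spin)

/-- The boundary spins given by a set of parts: `-` on the parts, `+` elsewhere. -/
def boundarySpin {l : ℕ} (M : ℕ) (part : Fin l → ℕ) (j : Fin (M + 1)) : Spin :=
  open Classical in if ∃ i, part i = (j : ℕ) then Spin.minus else Spin.plus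

/-- The boundary conditions: left and right boundary edges are all `+`, bottom and top boundary
edges are prescribed. -/
def HasBoundary {N M : ℕ} (bottom top : Fin (M + 1) → Spin) (s : State N M) : Prop :=
  (∀ k, s.1 k 0 = Spin.plus) ∧ (∀ k, s.1 k (Fin.last (M + 1)) = Spin.plus) ∧
    (∀ j, s.2 0 j = bottom j) ∧ (∀ j, s.2 (Fin.last N) j = top j)

/-- The partition function of a model whose vertex in (geometric) row `k` has the Boltzmann weight
`wt k left top right bottom`: the sum over all states with the given boundary of the product of the
weights of all vertices. Non-admissible vertices have weight `0`. -/
noncomputable def partitionFunction {R : Type*} [CommRing R] {N M : ℕ}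
    (wt : Fin N → Spin → Spin → Spin → Spin → R) (bottom top : Fin (M + 1) → Spin) : R :=
  open Classical in
  ∑ s : State N M with HasBoundary bottom top s,
    ∏ k : Fin N, ∏ j : Fin (M + 1),
      wt k (s.1 k j.castSucc) (s.2 k.succ j) (s.1 k j.succ) (s.2 k.castSucc j)

/-- The Boltzmann weights of `𝔖` (arguments: `left top right bottom`), in the order
`a₁, a₂, b₁, b₂, c₁, c₂`. -/
def weight {R : Type*} [CommRing R] (x y A B : R) : Spin → Spin → Spin → Spin → R
  | .plus, .plus, .plus, .plus => A
  | .minus, .minus, .minus, .minus => y * A * B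
  | .plus, .minus, .plus, .minus => A * B
  | .minus, .plus, .minus, .plus => x * A
  | .minus, .plus, .plus, .minus => (x + y) * A * B
  | .plus, .minus, .minus, .plus => A
  | _, _, _, _ => 0

/-- The Boltzmann weights of `𝔖*` (arguments: `left top right bottom`), in the order
`a₁, a₂, b₁, b₂, c₁, c₂`. -/
def weightStar {R : Type*} [CommRing R] (x y : R) (A B : Rˣ) : Spin → Spin → Spin → Spin → R
  | .plus, .plus, .plus, .plus => (A⁻¹ : Rˣ)
  | .minus, .minus, .minus, .minus => x * (A⁻¹ : Rˣ) * (B⁻¹ : Rˣ)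
  | .plus, .minus, .plus, .minus => (A⁻¹ : Rˣ) * (B⁻¹ : Rˣ)
  | .minus, .plus, .minus, .plus => y * (A⁻¹ : Rˣ)
  | .plus, .plus, .minus, .minus => (x + y) * (A⁻¹ : Rˣ)
  | .minus, .minus, .plus, .plus => (A⁻¹ : Rˣ) * (B⁻¹ : Rˣ)
  | _, _, _, _ => 0

/-- `Z(𝔖_{lam/mu}(x, y, A, B))` with `M + 1` columns, for strict partitions `lam`, `mu`: rows are
labelled from bottom to top, the bottom boundary is `lam` and the top boundary is `mu`. -/
noncomputable def Z {R : Type*} [CommRing R] {N l m : ℕ} (M : ℕ) (x y A B : Fin N → R)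
    (lam : Fin l → ℕ) (mu : Fin m → ℕ) : R :=
  partitionFunction (fun k => weight (x k) (y k) (A k) (B k))
    (boundarySpin M lam) (boundarySpin M mu)

/-- `Z(𝔖*_{lam/mu}(x, y, A, B))` with `M + 1` columns, for strict partitions `lam`, `mu`: rows are
labelled from top to bottom, the bottom boundary is `mu` and the top boundary is `lam`. -/
noncomputable def ZStar {R : Type*} [CommRing R] {N l m : ℕ} (M : ℕ) (x y : Fin N → R)
    (A B : Fin N → Rˣ) (lam : Fin l → ℕ) (mu : Fin m → ℕ) : R :=
  partitionFunction (fun k => weightStar (x k.rev) (y k.rev) (A k.rev) (B k.rev))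
    (boundarySpin M mu) (boundarySpin M lam)

/-! ### Supersymmetric Schur functions -/

/-- `[t|y]^r = (t + y₁)(t + y₂)⋯(t + y_r)`, where `y_k = 0` for `k > N`. -/
def shiftedPow {R : Type*} [CommRing R] {N : ℕ} (t : R) (y : Fin N → R) (r : ℕ) : R :=
  ∏ k ∈ Finset.range r, (t + if h : k < N then y ⟨k, h⟩ else 0)

/-- The alternant `A_e = det ([x_i|y]^{e_j})`. -/
def alternant {R : Type*} [CommRing R] {N : ℕ} (x y : Fin N → R) (e : Fin N → ℕ) : R :=
  Matrix.det (Matrix.of fun i j : Fin N => shiftedPow (x i) y (e j))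

open Polynomial in
/-- The alternant `A_ρ` divides every other alternant. -/
theorem alternant_rho_dvd {R : Type*} [CommRing R] {N : ℕ} (x y : Fin N → R) (e : Fin N → ℕ) :
    alternant x y (rhoShift 0) ∣ alternant x y e := by
  nontriviality R
  let P : ℕ → R[X] := fun r => ∏ k ∈ Finset.range r, (X + C (if h : k < N then y ⟨k, h⟩ else 0))
  have hP : ∀ t r, (P r).eval t = shiftedPow t y r := by
    intro t r
    simp only [P, shiftedPow, eval_prod, eval_add, eval_X, eval_C]
  have hdeg : ∀ r, (P r).natDegree = r := by
    intro r
    simp only [P]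
    rw [natDegree_prod_of_monic _ _ (fun _ _ => monic_X_add_C _)]
    simp
  have hmon : ∀ r, (P r).Monic := fun r => monic_prod_of_monic _ _ (fun _ _ => monic_X_add_C _)
  have h1 : (Matrix.vandermonde x).det
      = (Matrix.of fun i j : Fin N => shiftedPow (x i) y (j : ℕ)).det := by
    rw [Matrix.det_eval_matrixOfPolynomials_eq_det_vandermonde x (fun j => P j)
      (fun i => hdeg i) (fun i => hmon i)]
    simp only [hP]
  have h2 : alternant x y (rhoShift 0) ∣ (Matrix.vandermonde x).det := by
    rw [h1]
    have := Matrix.det_permute' (Fin.revPerm (n := N))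
      (Matrix.of fun i j : Fin N => shiftedPow (x i) y (j : ℕ))
    have h3 : alternant x y (rhoShift 0) = ((Matrix.of fun i j : Fin N =>
        shiftedPow (x i) y (j : ℕ)).submatrix id (Fin.revPerm (n := N))).det := by
      unfold alternant
      congr 1
      ext i j
      simp only [rhoShift, Matrix.of_apply, Matrix.submatrix_apply, id, Fin.revPerm_apply,
        Fin.val_rev, Pi.zero_apply, zero_add]
      congr 1
      omega
    rw [h3, this]
    rcases Int.units_eq_one_or (Equiv.Perm.sign (Fin.revPerm (n := N))) with h | h <;>
      simp [h]
  refine h2.trans ?_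
  let Q : R[X] := ∏ i, (X - C (x i))
  have hQ : Q.Monic := monic_prod_of_monic _ _ (fun _ _ => monic_X_sub_C _)
  have hQdeg : Q.natDegree = N := by
    simp only [Q]
    rw [natDegree_prod_of_monic _ _ (fun _ _ => monic_X_sub_C _)]
    simp
  have hQ0 : ∀ i, Q.eval (x i) = 0 := by
    intro i
    simp only [Q, eval_prod]
    exact Finset.prod_eq_zero (Finset.mem_univ i) (by simp)
  refine ⟨(Matrix.of fun i j : Fin N => (P (e j) %ₘ Q).coeff i).det, ?_⟩
  rw [← Matrix.det_mul]
  unfold alternant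
  congr 1
  ext i j
  rw [Matrix.of_apply, ← hP, Matrix.mul_apply]
  have h4 : (P (e j)).eval (x i) = (P (e j) %ₘ Q).eval (x i) := by
    conv_lhs => rw [← modByMonic_add_div (P (e j)) Q]
    simp [hQ0]
  have h5 : (P (e j) %ₘ Q).degree < N := by
    have := degree_modByMonic_lt (P (e j)) hQ
    rwa [degree_eq_natDegree hQ.ne_zero, hQdeg] at this
  rw [h4]
  rcases Nat.eq_zero_or_pos N with hN | hN
  · exact absurd i.2 (by omega)
  rw [eval_eq_sum_range' (n := N)]
  · rw [Finset.sum_range]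
    refine Finset.sum_congr rfl fun k _ => ?_
    simp only [Matrix.vandermonde_apply, Matrix.of_apply]
    ring
  · by_cases h0 : P (e j) %ₘ Q = 0
    · simpa [h0] using hN
    · exact (natDegree_lt_iff_degree_lt h0).2 h5

/-- The universal polynomial `s_lam[x|y] = A_{lam+ρ} / A_ρ` in the indeterminates
`x_1, …, x_N` (`Sum.inl`) and `y_1, …, y_N` (`Sum.inr`). The quotient exists by
`alternant_rho_dvd` and is unique, since `A_ρ` is (up to sign) the Vandermonde determinant in the
`x_i` and hence a nonzero element of an integral domain. -/
noncomputable def superSchurPoly (N : ℕ) (lam : Fin N → ℕ) : MvPolynomial (Fin N ⊕ Fin N) ℤ :=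
  Classical.choose (alternant_rho_dvd (fun i => MvPolynomial.X (Sum.inl i))
    (fun i => MvPolynomial.X (Sum.inr i)) (rhoShift lam))

/-- The one-row partition `(r)`, padded with zeroes to length `N`. -/
def oneRow (N r : ℕ) : Fin N → ℕ := fun i => if (i : ℕ) = 0 then r else 0

/-- `h_r[x|y] = s_{(r)}[x|y]` for `r ≥ 0`, and `h_r[x|y] = 0` for `r < 0`. -/
noncomputable def superH {R : Type*} [CommRing R] {N : ℕ} (x y : Fin N → R) (r : ℤ) : R :=
  if 0 ≤ r then MvPolynomial.aeval (Sum.elim x y) (superSchurPoly N (oneRow N r.toNat)) else 0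

/-- The skew supersymmetric Schur function
`s_{lam/mu}[x|y] = det (h_{lam_i - mu_j - i + j}[x|y])` for partitions of the same length `l`. -/
noncomputable def skewSuperSchur {R : Type*} [CommRing R] {N l : ℕ} (lam mu : Fin l → ℕ)
    (x y : Fin N → R) : R :=
  Matrix.det (Matrix.of fun i j : Fin l =>
    superH x y ((lam i : ℤ) - (mu j : ℤ) - ((i : ℕ) : ℤ) + ((j : ℕ) : ℤ)))

end SixVertex

namespace SixVertex

/-! The models are free fermionic. In a row of `𝔖` the `-` spins form particles that enter at the
top, move right and leave at the bottom. Up to the factors `A` and `B`, one particle going from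
column `j` to column `i` has weight `hop x y i j`, the coefficient of `T^(i-j)` in `(1 + yT)/(1 -
xT)`. With several particles, the row weight is the corresponding minor of the one-particle matrix
(`rowSum_gaugeWeight`).

Stacking rows sums products of minors over all intermediate configurations, so by Cauchy–Binet
(`det_mul_eq_sum_strictAnti`) the whole partition function is a minor of the product of the
one-particle matrices (`partitionFunction_eq_det`). These matrices are lower triangular Toeplitz, so
their product is the Toeplitz matrix of `∏ (1 + y_i T)/(1 - x_i T)`.

On the algebraic side, reducing the alternants modulo `∏ (X - x_i)` shows that this series generates
the `h_r` (`alternant_oneRow`, `coeff_modByMonic_eq_coeff_genSeries`, `superH_natCast`). The minor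
with rows `lam + ρ` and columns `mu + ρ` is then exactly the determinant defining `skewSuperSchur`.
Exchanging top and bottom turns `𝔖*` into the same model with `x` and `y` swapped and `A`, `B`
inverted, and transposes the matrices. -/

variable {R : Type*} [CommRing R]

/-! ### Determinants of arrays whose shape is only propositionally square -/

/-- The determinant of an `l × m` array, defined to be `0` unless `l = m`. -/
def rectDet {l m : ℕ} (f : Fin l → Fin m → R) : R :=
  if h : l = m then Matrix.det (Matrix.of fun i j => f i (Fin.cast h j)) else 0

theorem rectDet_self {l : ℕ} (f : Fin l → Fin l → R) : rectDet f = (Matrix.of f).det := by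
  simp [rectDet]

theorem rectDet_of_ne {l m : ℕ} (h : l ≠ m) (f : Fin l → Fin m → R) : rectDet f = 0 := by
  simp [rectDet, h]

theorem rectDet_succ_of_column_zero {l m : ℕ} (f : Fin (l + 1) → Fin (m + 1) → R)
    (h : ∀ i : Fin l, f i.succ 0 = 0) :
    rectDet f = f 0 0 * rectDet fun (i : Fin l) (j : Fin m) => f i.succ j.succ := by
  by_cases hlm : l = m
  · subst hlm
    rw [rectDet_self, rectDet_self, Matrix.det_succ_column_zero, Fin.sum_univ_succ]
    simp only [Matrix.of_apply, h]
    simp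
    rfl
  · rw [rectDet_of_ne (by omega), rectDet_of_ne hlm, mul_zero]

theorem rectDet_eq_zero_of_column_zero {l m : ℕ} (f : Fin l → Fin (m + 1) → R)
    (h : ∀ i, f i 0 = 0) : rectDet f = 0 := by
  by_cases hlm : l = m + 1
  · subst hlm
    rw [rectDet_self]
    exact Matrix.det_eq_zero_of_column_eq_zero 0 h
  · exact rectDet_of_ne hlm _

theorem rectDet_smul_row_zero {l m : ℕ} (f g : Fin (l + 1) → Fin m → R) (c : R)
    (h0 : ∀ j, f 0 j = c * g 0 j) (h : ∀ (i : Fin l) j, f i.succ j = g i.succ j) :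
    rectDet f = c * rectDet g := by
  by_cases hlm : l + 1 = m
  · subst hlm
    rw [rectDet_self, rectDet_self]
    have : Matrix.of f = (Matrix.of g).updateRow 0 (c • g 0) := by
      ext i j
      refine Fin.cases ?_ (fun i => ?_) i
      · simp [h0]
      · simp [h]
    rw [this, Matrix.det_updateRow_smul]
    congr 2
    exact Matrix.updateRow_eq_self _ _
  · rw [rectDet_of_ne hlm, rectDet_of_ne hlm, mul_zero]

theorem rectDet_add_row {l m : ℕ} (f g : Fin (l + 2) → Fin m → R) (c : R)
    (h1 : ∀ j, g 1 j = f 1 j + c * f 0 j) (h0 : g 0 = f 0)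
    (h : ∀ i : Fin l, g i.succ.succ = f i.succ.succ) :
    rectDet g = rectDet f := by
  by_cases hlm : l + 2 = m
  · subst hlm
    rw [rectDet_self, rectDet_self]
    have : Matrix.of g = (Matrix.of f).updateRow 1 ((Matrix.of f) 1 + c • (Matrix.of f) 0) := by
      ext i j
      refine Fin.cases ?_ (fun i => Fin.cases ?_ (fun i => ?_) i) i
      · simp [h0]
      · simp [h1]
      · simp [h, Fin.ext_iff, Matrix.updateRow_apply]
    rw [this, Matrix.det_updateRow_add_smul_self]
    exact (Fin.zero_ne_one).symm
  · rw [rectDet_of_ne hlm, rectDet_of_ne hlm]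

theorem rectDet_eq_zero_of_row {l m : ℕ} (f : Fin (l + 1) → Fin m → R) (i : Fin (l + 1))
    (h : ∀ j, f i j = 0) : rectDet f = 0 := by
  by_cases hlm : l + 1 = m
  · subst hlm
    rw [rectDet_self]
    exact Matrix.det_eq_zero_of_row_eq_zero i h
  · exact rectDet_of_ne hlm _

/-! ### Rows of the lattice -/

/-- The partition function of the first `n` columns of a row, with left edge `+`, right edge `σ`,
bottom spins `b` and top spins `t`. -/
def rowSum (w : Spin → Spin → Spin → Spin → R) : ℕ → Spin → (ℕ → Spin) → (ℕ → Spin) → R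
  | 0, σ, _, _ => if σ = Spin.plus then 1 else 0
  | n + 1, σ, b, t =>
    rowSum w n Spin.plus b t * w Spin.plus (t n) σ (b n) +
      rowSum w n Spin.minus b t * w Spin.minus (t n) σ (b n)

/-- The spins `b` in the first `n` columns are `-` exactly at the decreasing positions `p`. -/
structure IsConfig (n : ℕ) {l : ℕ} (p : Fin l → ℕ) (b : ℕ → Spin) : Prop where
  anti : StrictAnti p
  lt : ∀ i, p i < n
  minus_iff : ∀ j < n, (b j = Spin.minus ↔ ∃ i, p i = j)

theorem IsConfig.eq_zero {l : ℕ} {p : Fin l → ℕ} {b : ℕ → Spin} (h : IsConfig 0 p b) : l = 0 := by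
  rcases l with _ | l
  · rfl
  · exact absurd (h.lt 0) (by simp)

theorem IsConfig.of_plus {n l : ℕ} {p : Fin l → ℕ} {b : ℕ → Spin} (h : IsConfig (n + 1) p b)
    (hb : b n = Spin.plus) : IsConfig n p b where
  anti := h.anti
  lt i := by
    have h1 := h.lt i
    have h2 : p i ≠ n := fun h2 => by
      have := (h.minus_iff n (by omega)).2 ⟨i, h2⟩
      simp [hb] at this
    omega
  minus_iff j hj := h.minus_iff j (by omega)

/-- Positions decrease, so a `-` in the last column has index `0`; removing that column strips the
first row or column of the determinant. -/
theorem IsConfig.of_minus {n l : ℕ} {p : Fin l → ℕ} {b : ℕ → Spin} (h : IsConfig (n + 1) p b)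
    (hb : b n = Spin.minus) : ∃ k, ∃ hk : l = k + 1, ∃ p' : Fin k → ℕ,
      IsConfig n p' b ∧ ∀ i, p i = (Fin.cons n p' : Fin (k + 1) → ℕ) (Fin.cast hk i) := by
  obtain ⟨i, hi⟩ := (h.minus_iff n (by omega)).1 hb
  rcases l with _ | k
  · exact i.elim0
  have h0 : p 0 = n := by
    have h1 := h.lt 0
    have h2 := h.anti.antitone (Fin.zero_le i)
    omega
  refine ⟨k, rfl, fun i => p i.succ, ⟨fun a c hac => h.anti (by simpa using hac), fun j => ?_,
    fun j hj => ?_⟩, fun j => ?_⟩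
  · have := h.anti (Fin.succ_pos j)
    omega
  · rw [h.minus_iff j (by omega), Fin.exists_fin_succ]
    constructor
    · rintro (h1 | h1)
      · omega
      · exact h1
    · exact Or.inr
  · refine Fin.cases ?_ (fun j => ?_) j
    · simpa using h0
    · simp

/-- The Boltzmann weights `weight` and `weightStar` up to exchanging a factor between the two
types of corners. -/
def gaugeWeight (x y A B u v : R) : Spin → Spin → Spin → Spin → R
  | .plus, .plus, .plus, .plus => A
  | .minus, .minus, .minus, .minus => y * A * B
  | .plus, .minus, .plus, .minus => A * B
  | .minus, .plus, .minus, .plus => x * A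
  | .minus, .plus, .plus, .minus => u * A * B
  | .plus, .minus, .minus, .plus => v * A
  | _, _, _, _ => 0

/-- The weight of a single particle that moves from column `j` to column `i` within one row. -/
def hop (x y : R) (i j : ℕ) : R :=
  if i < j then 0 else if i = j then 1 else (x + y) * x ^ (i - j - 1)

theorem hop_self (x y : R) (n : ℕ) : hop x y n n = 1 := by simp [hop]

theorem hop_of_lt (x y : R) {i j : ℕ} (h : i < j) : hop x y i j = 0 := by simp [hop, h]

theorem hop_of_gt (x y : R) {i j : ℕ} (h : j < i) :
    hop x y i j = (x + y) * x ^ (i - j - 1) := by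
  simp [hop, h.ne', h.not_gt]

/-- The array of one-particle weights, with an additional first row for the particle that is still
moving when it leaves the first `n` columns. -/
def openArray (x y : R) (n : ℕ) {l m : ℕ} (p : Fin l → ℕ) (q : Fin m → ℕ) :
    Fin (l + 1) → Fin m → R :=
  Fin.cons (fun j => x ^ (n - 1 - q j)) fun i j => hop x y (p i) (q j)

/-- Induction on the columns, carrying both values of the right edge at once: each new column
amounts to a row operation or an expansion along column `0`. Every vertex contributes `A`, those
with bottom spin `-` also `B`. A particle that turns into the row and out again contributes `v * u`,
so a closed row sees only this product; an open row keeps one unmatched `v`. -/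
theorem rowSum_gaugeWeight (x y A B u v : R) (huv : u * v = x + y) (n : ℕ) :
    ∀ {l m : ℕ} (p : Fin l → ℕ) (q : Fin m → ℕ) (b t : ℕ → Spin),
      IsConfig n p b → IsConfig n q t →
      rowSum (gaugeWeight x y A B u v) n Spin.plus b t =
          A ^ n * B ^ l * rectDet (fun i j => hop x y (p i) (q j)) ∧
        rowSum (gaugeWeight x y A B u v) n Spin.minus b t =
          v * A ^ n * B ^ l * rectDet (openArray x y n p q) := by
  induction n with
  | zero =>
    intro l m p q b t hp hq
    obtain rfl := hp.eq_zero
    obtain rfl := hq.eq_zero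
    constructor
    · simp [rowSum, rectDet_self]
    · simp [rowSum, rectDet_of_ne]
  | succ n ih =>
    intro l m p q b t hp hq
    rcases hb : b n with _ | _ <;> rcases ht : t n with _ | _
    · have hp' := hp.of_plus hb
      have hq' := hq.of_plus ht
      obtain ⟨ih1, ih2⟩ := ih p q b t hp' hq'
      constructor
      · simp only [rowSum, hb, ht, gaugeWeight, ih1]
        ring
      · simp only [rowSum, hb, ht, gaugeWeight, ih2]
        rw [rectDet_smul_row_zero (openArray x y (n + 1) p q) (openArray x y n p q) x]
        · ring
        · intro j
          simp only [openArray, Fin.cons_zero]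
          rw [← pow_succ']
          have := hq'.lt j
          congr 1
          omega
        · intro i j
          simp [openArray]
    · have hp' := hp.of_plus hb
      obtain ⟨m, rfl, q', hq', hqq⟩ := hq.of_minus ht
      obtain rfl : q = Fin.cons n q' := funext hqq
      obtain ⟨ih1, ih2⟩ := ih p q' b t hp' hq'
      constructor
      -- A particle entering at the last column cannot leave below, so the right edge must be `-`.
      · rw [rectDet_eq_zero_of_column_zero]
        · simp [rowSum, hb, ht, gaugeWeight]
        · intro i
          exact hop_of_lt _ _ (hp'.lt i)
      · rw [rectDet_succ_of_column_zero]
        · simp only [rowSum, hb, ht, gaugeWeight, ih1, openArray, Fin.cons_zero, Fin.cons_succ]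
          simp
          ring
        · intro i
          exact hop_of_lt _ _ (hp'.lt i)
    · have hq' := hq.of_plus ht
      obtain ⟨l, rfl, p', hp', hpp⟩ := hp.of_minus hb
      obtain rfl : p = Fin.cons n p' := funext hpp
      obtain ⟨ih1, ih2⟩ := ih p' q b t hp' hq'
      have hrow : ∀ j, hop x y n (q j) = (x + y) * x ^ (n - 1 - q j) := fun j => by
        rw [hop_of_gt _ _ (hq'.lt j)]
        congr 2
        omega
      constructor
      -- The particle leaving at column `n` is the one still moving; its row is `x + y` times the
      -- open row.
      · rw [rectDet_smul_row_zero _ (openArray x y n p' q) (x + y)]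
        · simp only [rowSum, hb, ht, gaugeWeight, ih2, ← huv]
          ring
        · intro j
          simp [openArray, hrow]
        · intro i j
          simp [openArray]
      -- The open row and the row of the particle leaving at `n` are both multiples of `x ^ (n - 1 -
      -- q j)`, so the determinant vanishes, as does the vertex weight.
      · have hz : rectDet (openArray x y (n + 1) (Fin.cons n p' : Fin (l + 1) → ℕ) q) = 0 := by
          rw [rectDet_smul_row_zero _ (Fin.cons (fun j => x ^ (n - 1 - q j))
            fun i j => hop x y ((Fin.cons n p' : Fin (l + 1) → ℕ) i) (q j)) x]
          · rw [← rectDet_add_row _ (Fin.cons (fun j => x ^ (n - 1 - q j))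
              (Fin.cons 0 fun i j => hop x y (p' i) (q j))) (-(x + y)),
              rectDet_eq_zero_of_row _ 1 (fun _ => rfl), mul_zero]
            · intro j
              change 0 = hop x y n (q j) + -(x + y) * x ^ (n - 1 - q j)
              rw [hrow]
              ring
            · rfl
            · intro i
              rfl
          · intro j
            simp only [openArray, Fin.cons_zero]
            rw [← pow_succ']
            have := hq'.lt j
            congr 1
            omega
          · intro i j
            simp [openArray]
        rw [hz]
        simp [rowSum, hb, ht, gaugeWeight]
    · obtain ⟨l, rfl, p', hp', hpp⟩ := hp.of_minus hb
      obtain rfl : p = Fin.cons n p' := funext hpp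
      obtain ⟨m, rfl, q', hq', hqq⟩ := hq.of_minus ht
      obtain rfl : q = Fin.cons n q' := funext hqq
      obtain ⟨ih1, ih2⟩ := ih p' q' b t hp' hq'
      constructor
      · rw [rectDet_succ_of_column_zero]
        · simp only [rowSum, hb, ht, gaugeWeight, ih1, Fin.cons_zero, Fin.cons_succ, hop_self]
          ring
        · intro i
          exact hop_of_lt _ _ (hp'.lt i)
      -- Subtracting the open row from the next one clears its entry in column `0` and leaves `(x +
      -- y) x^d - x^(d+1) = y x^d` elsewhere: this is the weight `y` of the vertex `(----)`.
      · rw [← rectDet_add_row _ (Fin.cons (fun j => x ^ (n - (Fin.cons n q' : Fin (m + 1) → ℕ) j))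
          (Fin.cons (Fin.cons 0 fun j => y * x ^ (n - 1 - q' j))
            fun i j => hop x y (p' i) ((Fin.cons n q' : Fin (m + 1) → ℕ) j))) (-1),
          rectDet_succ_of_column_zero, rectDet_smul_row_zero _ (openArray x y n p' q') y]
        · simp only [rowSum, hb, ht, gaugeWeight, ih2, Fin.cons_zero]
          simp
          ring
        · intro j
          simp [openArray]
        · intro i j
          simp [openArray]
        · intro i
          refine Fin.cases rfl (fun i => ?_) i
          exact hop_of_lt _ _ (hp'.lt i)
        · intro j
          refine Fin.cases ?_ (fun j => ?_) j
          · change 0 = hop x y n n + -1 * x ^ (n - n)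
            simp [hop_self]
          · change y * x ^ (n - 1 - q' j) = hop x y n (q' j) + -1 * x ^ (n - q' j)
            have h1 := hq'.lt j
            rw [hop_of_gt _ _ h1, show n - q' j = (n - 1 - q' j) + 1 by omega,
              show n - 1 - q' j + 1 - 1 = n - 1 - q' j by omega]
            ring
        · rfl
        · intro i
          rfl

/-! ### The Cauchy–Binet formula -/

theorem exists_strictAnti_comp_perm {l m : ℕ} (f : Fin l → Fin m) (hf : Function.Injective f) :
    ∃ (q : Fin l → Fin m) (τ : Equiv.Perm (Fin l)), StrictAnti q ∧ f = q ∘ τ := by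
  let σ : Equiv.Perm (Fin l) := Fin.revPerm.trans (Tuple.sort f)
  refine ⟨f ∘ σ, σ⁻¹, ?_, ?_⟩
  · have h : Antitone (f ∘ σ) := fun i j hij => by
      have := Tuple.monotone_sort f (Fin.rev_le_rev.2 hij)
      simpa [σ] using this
    exact h.strictAnti_of_injective (hf.comp σ.injective)
  · ext i
    simp

theorem strictAnti_ext {l m : ℕ} {q q' : Fin l → Fin m} (hq : StrictAnti q) (hq' : StrictAnti q')
    (h : Set.range q = Set.range q') : q = q' := by
  have h1 := hq.dual_right
  have h2 := hq'.dual_right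
  have := (StrictMono.range_inj h1 h2).1 (by
    rw [Set.range_comp, Set.range_comp, h])
  funext i
  simpa using congrFun this i

-- Expanding the left side gives a sum over all column choices; repeated choices vanish, and an
-- injective choice is uniquely a decreasing one composed with a permutation.
open Classical in
theorem det_mul_eq_sum_strictAnti {l m : ℕ} (A : Matrix (Fin l) (Fin m) R)
    (B : Matrix (Fin m) (Fin l) R) :
    (A * B).det = ∑ q : Fin l → Fin m with StrictAnti q,
      (A.submatrix id q).det * (B.submatrix q id).det := by
  have h1 : (A * B).det = ∑ p : Fin l → Fin m, (A.submatrix id p).det * ∏ i, B (p i) i := by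
    simp only [Matrix.det_apply', Matrix.mul_apply, Finset.prod_univ_sum, Finset.mul_sum,
      Fintype.piFinset_univ, Finset.sum_mul]
    rw [Finset.sum_comm]
    refine Finset.sum_congr rfl fun p _ => Finset.sum_congr rfl fun σ _ => ?_
    rw [Finset.prod_mul_distrib, ← mul_assoc]
    rfl
  have h2 : ∀ q : Fin l → Fin m, (A.submatrix id q).det * (B.submatrix q id).det =
      ∑ τ : Equiv.Perm (Fin l), (A.submatrix id (q ∘ τ)).det * ∏ i, B ((q ∘ τ) i) i := by
    intro q
    rw [Matrix.det_apply' (B.submatrix q id), Finset.mul_sum]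
    refine Finset.sum_congr rfl fun τ _ => ?_
    have := Matrix.det_permute' τ (A.submatrix id q)
    rw [Matrix.submatrix_submatrix] at this
    rw [show A.submatrix id (q ∘ τ) = A.submatrix (id ∘ id) (q ∘ τ) from rfl, this]
    simp only [Matrix.submatrix_apply, Function.comp_apply, id]
    ring
  rw [h1, Finset.sum_congr rfl fun q _ => h2 q, Finset.sum_sigma']
  symm
  refine Finset.sum_of_injOn (fun a => a.1 ∘ a.2) ?_ (by simp) ?_ (fun _ _ => rfl)
  · rintro ⟨q, τ⟩ hq ⟨q', τ'⟩ hq' h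
    simp only [Finset.coe_sigma, Set.mem_sigma_iff, Finset.coe_filter, Set.mem_ofPred_eq,
      Finset.mem_univ, true_and, Finset.coe_univ, Set.mem_univ, and_true] at hq hq'
    simp only at h
    obtain rfl : q = q' := strictAnti_ext hq hq' (by
      rw [← τ.surjective.range_comp q, ← τ'.surjective.range_comp q', h])
    obtain rfl : τ = τ' := Equiv.ext fun i => hq.injective (congrFun h i)
    rfl
  · intro p _ hp
    have hninj : ¬ Function.Injective p := fun hinj => by
      obtain ⟨q, τ, hq, rfl⟩ := exists_strictAnti_comp_perm p hinj
      exact hp ⟨⟨q, τ⟩, by simpa using hq, rfl⟩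
    obtain ⟨i, j, hij, hne⟩ : ∃ i j, p i = p j ∧ i ≠ j := by
      simpa [Function.Injective] using hninj
    rw [Matrix.det_zero_of_column_eq hne (fun k => by simp [hij]), zero_mul]

/-! ### Decomposition of the partition function into rows -/

open Classical in
/-- The partition function of a single row with left and right edge `+`. -/
noncomputable def rowFunction {M : ℕ} (w : Spin → Spin → Spin → Spin → R)
    (b t : Fin (M + 1) → Spin) : R :=
  ∑ h : Fin (M + 2) → Spin with h 0 = Spin.plus ∧ h (Fin.last (M + 1)) = Spin.plus,
    ∏ j : Fin (M + 1), w (h j.castSucc) (t j) (h j.succ) (b j)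

theorem sum_spin {S : Type*} [AddCommMonoid S] (f : Spin → S) :
    ∑ s, f s = f Spin.plus + f Spin.minus := by
  change ∑ s ∈ {Spin.plus, Spin.minus}, f s = _
  rw [Finset.sum_pair (by decide)]

open Classical in
theorem sum_eq_rowSum (w : Spin → Spin → Spin → Spin → R) (b t : ℕ → Spin) (n : ℕ) (σ : Spin) :
    (∑ h : Fin (n + 1) → Spin with h 0 = Spin.plus ∧ h (Fin.last n) = σ,
      ∏ j : Fin n, w (h j.castSucc) (t j) (h j.succ) (b j)) = rowSum w n σ b t := by
  induction n generalizing σ with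
  | zero =>
    rw [Finset.sum_filter, ← (Equiv.funUnique (Fin 1) Spin).symm.sum_comp, sum_spin]
    cases σ <;> simp [rowSum]
  | succ n ih =>
    simp only [Finset.sum_filter] at ih ⊢
    rw [← (Fin.snocEquiv fun _ : Fin (n + 2) => Spin).sum_comp, Fintype.sum_prod_type,
      Finset.sum_comm]
    have hr : rowSum w (n + 1) σ b t =
        ∑ σ', rowSum w n σ' b t * w σ' (t n) σ (b n) := by
      rw [sum_spin, rowSum]
    simp only [hr, ← ih, Finset.sum_mul]
    conv_rhs => rw [Finset.sum_comm]
    refine Finset.sum_congr rfl fun h _ => ?_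
    have h0 : ∀ s : Spin, (Fin.snocEquiv fun _ : Fin (n + 2) => Spin) (s, h) 0 = h 0 := fun s => by
      rw [← Fin.castSucc_zero]
      simp [Fin.snocEquiv]
    rw [Finset.sum_eq_single σ, Finset.sum_eq_single (h (Fin.last n))]
    · rw [h0]
      simp [Fin.prod_univ_castSucc, ← Fin.castSucc_succ, Fin.snocEquiv]
    · intro s _ hs
      simp [hs.symm]
    · simp
    · intro s _ hs
      simp [Fin.snocEquiv, hs]
    · simp

theorem partitionFunction_zero {M : ℕ} (wt : Fin 0 → Spin → Spin → Spin → Spin → R)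
    (bottom top : Fin (M + 1) → Spin) [Decidable (bottom = top)] :
    partitionFunction wt bottom top = if bottom = top then 1 else 0 := by
  classical
  unfold partitionFunction
  rw [Finset.sum_filter]
  simp only [Finset.univ_eq_empty, Finset.prod_empty]
  split_ifs with h
  · rw [Finset.sum_eq_single (default, fun _ => bottom)]
    · simp [HasBoundary, h]
    · rintro ⟨a, v⟩ _ hs
      refine if_neg fun hb => hs ?_
      ext1
      · exact Subsingleton.elim _ _
      · funext k
        rw [show k = 0 from Fin.fin_one_eq_zero k]
        exact funext hb.2.2.1
    · simp
  · refine Finset.sum_eq_zero fun s _ => if_neg fun hb => h ?_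
    funext j
    rw [← hb.2.2.1, ← hb.2.2.2]
    rfl

theorem partitionFunction_succ {N M : ℕ} (wt : Fin (N + 1) → Spin → Spin → Spin → Spin → R)
    (bottom top : Fin (M + 1) → Spin) :
    partitionFunction wt bottom top = ∑ ν : Fin (M + 1) → Spin,
      rowFunction (wt 0) bottom ν * partitionFunction (fun k => wt k.succ) ν top := by
  classical
  -- Splits off the horizontal edges of the lowest row together with the vertical edges below it.
  let e := (Equiv.prodProdProdComm (Fin (M + 2) → Spin) (Fin (M + 1) → Spin)
    (Fin N → Fin (M + 2) → Spin) (Fin (N + 1) → Fin (M + 1) → Spin)).trans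
      (Equiv.prodCongr (Fin.consEquiv fun _ : Fin (N + 1) => Fin (M + 2) → Spin)
        (Fin.consEquiv fun _ : Fin (N + 2) => Fin (M + 1) → Spin))
  have he : ∀ h v s, e ((h, v), s) = (Fin.cons h s.1, Fin.cons v s.2) := fun _ _ _ => rfl
  have hB : ∀ h v s, HasBoundary bottom top (e ((h, v), s)) ↔
      (h 0 = Spin.plus ∧ h (Fin.last (M + 1)) = Spin.plus) ∧ v = bottom ∧
        HasBoundary (s.2 0) top s := by
    intro h v s
    simp only [HasBoundary, he, Fin.forall_fin_succ (n := N), Fin.cons_zero, Fin.cons_succ,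
      funext_iff, ← Fin.succ_last, true_and, implies_true]
    tauto
  have hW : ∀ h v s, (∏ k : Fin (N + 1), ∏ j : Fin (M + 1),
      wt k ((e ((h, v), s)).1 k j.castSucc) ((e ((h, v), s)).2 k.succ j)
        ((e ((h, v), s)).1 k j.succ) ((e ((h, v), s)).2 k.castSucc j)) =
      (∏ j : Fin (M + 1), wt 0 (h j.castSucc) (s.2 0 j) (h j.succ) (v j)) *
        ∏ k : Fin N, ∏ j : Fin (M + 1), wt k.succ (s.1 k j.castSucc) (s.2 k.succ j)
          (s.1 k j.succ) (s.2 k.castSucc j) := by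
    intro h v s
    rw [Fin.prod_univ_succ]
    simp only [he, ← Fin.succ_castSucc, Fin.castSucc_zero, Fin.cons_zero, Fin.cons_succ]
  unfold partitionFunction
  simp only [rowFunction, Finset.sum_filter]
  rw [← e.sum_comp, Fintype.sum_prod_type, Fintype.sum_prod_type]
  simp only [hB, hW, Finset.sum_mul_sum]
  conv_rhs => rw [Finset.sum_comm]
  refine Finset.sum_congr rfl fun h _ => ?_
  rw [Finset.sum_comm]
  conv_rhs => rw [Finset.sum_comm]
  refine Finset.sum_congr rfl fun s _ => ?_
  rw [Finset.sum_eq_single bottom, Finset.sum_eq_single (s.2 0)]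
  · simp only [true_and, ite_zero_mul_ite_zero]
  · intro ν _ hν
    rw [if_neg fun hb : HasBoundary ν top s => hν (funext hb.2.2.1).symm, mul_zero]
  · simp
  · intro v _ hv
    exact if_neg fun hb => hv hb.2.1
  · simp

/-! ### Boundary spins given by decreasing sequences -/

/-- The spins that are `-` exactly in the columns `p i`. -/
noncomputable def spins {l M : ℕ} (p : Fin l → Fin (M + 1)) : Fin (M + 1) → Spin :=
  boundarySpin M fun i => (p i : ℕ)

theorem spins_eq_minus_iff {l M : ℕ} (p : Fin l → Fin (M + 1)) (j : Fin (M + 1)) :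
    spins p j = Spin.minus ↔ j ∈ Set.range p := by
  simp [spins, boundarySpin, Fin.ext_iff]

theorem Spin.ext_minus {s t : Spin} (h : s = Spin.minus ↔ t = Spin.minus) : s = t := by
  cases s <;> cases t <;> simp_all

theorem spins_inj {l M : ℕ} {p q : Fin l → Fin (M + 1)} (hp : StrictAnti p) (hq : StrictAnti q)
    (h : spins p = spins q) : p = q := by
  refine strictAnti_ext hp hq (Set.ext fun j => ?_)
  rw [← spins_eq_minus_iff, ← spins_eq_minus_iff, h]

theorem exists_spins {M : ℕ} (ν : Fin (M + 1) → Spin) :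
    ∃ (l : ℕ) (p : Fin l → Fin (M + 1)), StrictAnti p ∧ spins p = ν := by
  classical
  let s : Finset (Fin (M + 1)) := Finset.univ.filter fun j => ν j = Spin.minus
  refine ⟨s.card, s.orderEmbOfFin rfl ∘ Fin.rev,
    (s.orderEmbOfFin rfl).strictMono.comp_strictAnti Fin.rev_strictAnti, ?_⟩
  funext j
  refine Spin.ext_minus ?_
  rw [spins_eq_minus_iff, Fin.rev_surjective.range_comp, Finset.range_orderEmbOfFin]
  simp [s]

/-- Cauchy–Binet, one row at a time. `hW` covers `l ≠ m` as well, where `rectDet` is `0`: this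
discards intermediate configurations with the wrong number of particles. -/
theorem partitionFunction_eq_det {N M : ℕ} (wt : Fin N → Spin → Spin → Spin → Spin → R)
    (c : Fin N → ℕ → R) (W : Fin N → Matrix (Fin (M + 1)) (Fin (M + 1)) R)
    (hW : ∀ k {l m : ℕ} (p : Fin l → Fin (M + 1)) (q : Fin m → Fin (M + 1)), StrictAnti p →
      StrictAnti q → rowFunction (wt k) (spins p) (spins q) =
        c k l * rectDet fun i j => W k (p i) (q j))
    {l : ℕ} (p q : Fin l → Fin (M + 1)) (hp : StrictAnti p) (hq : StrictAnti q) :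
    partitionFunction wt (spins p) (spins q) =
      (∏ k, c k l) * ((List.ofFn W).prod.submatrix p q).det := by
  classical
  induction N generalizing p with
  | zero =>
    rw [partitionFunction_zero]
    simp only [Finset.univ_eq_empty, Finset.prod_empty, one_mul, List.ofFn_zero, List.prod_nil]
    split_ifs with h
    · obtain rfl := spins_inj hp hq h
      rw [Matrix.submatrix_one _ hp.injective, Matrix.det_one]
    -- Distinct decreasing sequences of equal length have different ranges, which gives a zero row
    -- in the minor of the identity.
    · obtain ⟨i, hi⟩ : ∃ i, p i ∉ Set.range q := by
        by_contra! hcon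
        have hsub : Finset.univ.image p ⊆ Finset.univ.image q := fun j hj => by
          obtain ⟨i, -, rfl⟩ := Finset.mem_image.1 hj
          obtain ⟨k, hk⟩ := hcon i
          exact Finset.mem_image.2 ⟨k, Finset.mem_univ _, hk⟩
        have heq := Finset.eq_of_subset_of_card_le hsub (by
          rw [Finset.card_image_of_injective _ hp.injective,
            Finset.card_image_of_injective _ hq.injective])
        have hpq : p = q := strictAnti_ext hp hq (by
          simpa [← Finset.coe_inj] using heq)
        exact h (by rw [hpq])
      refine (Matrix.det_eq_zero_of_row_eq_zero i fun j => ?_).symm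
      exact Matrix.one_apply_ne fun h => hi ⟨j, h.symm⟩
  | succ N ih =>
    rw [partitionFunction_succ, List.ofFn_succ, List.prod_cons, Fin.prod_univ_succ,
      ← Matrix.submatrix_mul_equiv _ _ p (Equiv.refl _) q, det_mul_eq_sum_strictAnti,
      Finset.mul_sum]
    symm
    refine Finset.sum_of_injOn spins ?_ (by simp) ?_ ?_
    · intro r hr r' hr' h
      exact spins_inj (by simpa using hr) (by simpa using hr') h
    · intro ν _ hν
      obtain ⟨m, r, hr, rfl⟩ := exists_spins ν
      have hm : l ≠ m := by
        rintro rfl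
        exact hν ⟨r, by simpa using hr, rfl⟩
      rw [hW 0 p r hp hr, rectDet_of_ne hm, mul_zero, zero_mul]
    · intro r hr
      have hr' : StrictAnti r := by simpa using hr
      rw [hW 0 p r hp hr', rectDet_self,
        ih (fun k => wt k.succ) (fun k => c k.succ) (fun k => W k.succ) (fun k => hW k.succ) r hr']
      simp only [Matrix.submatrix_submatrix]
      have h1 : (Matrix.of fun i j => W 0 (p i) (r j)) = (W 0).submatrix (p ∘ id) r := rfl
      rw [h1]
      simp
      ring

theorem isConfig_spins {l M : ℕ} {p : Fin l → Fin (M + 1)} (hp : StrictAnti p) :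
    IsConfig (M + 1) (fun i => (p i : ℕ)) fun j =>
      if h : j < M + 1 then spins p ⟨j, h⟩ else Spin.plus where
  anti := fun _ _ h => hp h
  lt i := (p i).2
  minus_iff j hj := by
    simp [hj, spins_eq_minus_iff, Fin.ext_iff]

theorem rowFunction_gaugeWeight {M l m : ℕ} (x y A B u v : R) (huv : u * v = x + y)
    (p : Fin l → Fin (M + 1)) (q : Fin m → Fin (M + 1)) (hp : StrictAnti p) (hq : StrictAnti q) :
    rowFunction (gaugeWeight x y A B u v) (spins p) (spins q) =
      A ^ (M + 1) * B ^ l * rectDet fun i j => hop x y (p i) (q j) := by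
  rw [← (rowSum_gaugeWeight x y A B u v huv (M + 1) _ _ _ _ (isConfig_spins hp)
    (isConfig_spins hq)).1, ← sum_eq_rowSum]
  simp only [rowFunction, Fin.is_lt, dite_true, Fin.eta]

/-! ### The generating function of `superH` -/

open Polynomial in
/-- `[X|y]^r` as a polynomial. -/
noncomputable def shiftedPowPoly {N : ℕ} (y : Fin N → R) (r : ℕ) : R[X] :=
  ∏ k ∈ Finset.range r, (X + C (if h : k < N then y ⟨k, h⟩ else 0))

open Polynomial in
theorem eval_shiftedPowPoly {N : ℕ} (y : Fin N → R) (t : R) (r : ℕ) :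
    (shiftedPowPoly y r).eval t = shiftedPow t y r := by
  simp only [shiftedPowPoly, shiftedPow, eval_prod, eval_add, eval_X, eval_C]

open Polynomial in
theorem monic_shiftedPowPoly {N : ℕ} (y : Fin N → R) (r : ℕ) : (shiftedPowPoly y r).Monic :=
  monic_prod_of_monic _ _ fun _ _ => monic_X_add_C _

open Polynomial in
theorem natDegree_shiftedPowPoly [Nontrivial R] {N : ℕ} (y : Fin N → R) (r : ℕ) :
    (shiftedPowPoly y r).natDegree = r := by
  rw [shiftedPowPoly, natDegree_prod_of_monic _ _ fun _ _ => monic_X_add_C _]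
  simp

open Polynomial in
theorem shiftedPowPoly_add {N : ℕ} (y : Fin N → R) (r : ℕ) :
    shiftedPowPoly y (N + r) = X ^ r * ∏ k, (X + C (y k)) := by
  rw [shiftedPowPoly, Finset.prod_range_add, mul_comm]
  congr 1
  · simp
  · rw [Finset.prod_range]
    simp

open Polynomial in
/-- The polynomial whose roots are the `x i`. -/
noncomputable def rootPoly {N : ℕ} (x : Fin N → R) : R[X] := ∏ i, (X - C (x i))

open Polynomial in
theorem monic_rootPoly {N : ℕ} (x : Fin N → R) : (rootPoly x).Monic :=
  monic_prod_of_monic _ _ fun _ _ => monic_X_sub_C _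

open Polynomial in
theorem natDegree_rootPoly [Nontrivial R] {N : ℕ} (x : Fin N → R) :
    (rootPoly x).natDegree = N := by
  rw [rootPoly, natDegree_prod_of_monic _ _ fun _ _ => monic_X_sub_C _]
  simp

open Polynomial in
theorem degree_modByMonic_rootPoly_lt [Nontrivial R] {N : ℕ} (x : Fin N → R) (P : R[X]) :
    (P %ₘ rootPoly x).degree < N := by
  have := degree_modByMonic_lt P (monic_rootPoly x)
  rwa [degree_eq_natDegree (monic_rootPoly x).ne_zero, natDegree_rootPoly] at this

open Polynomial in
theorem natDegree_modByMonic_rootPoly_lt [Nontrivial R] {N : ℕ} (hN : 0 < N) (x : Fin N → R)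
    (P : R[X]) : (P %ₘ rootPoly x).natDegree < N := by
  by_cases h0 : P %ₘ rootPoly x = 0
  · simpa [h0] using hN
  · exact (natDegree_lt_iff_degree_lt h0).2 (degree_modByMonic_rootPoly_lt x P)

open Polynomial in
theorem eval_eq_sum_coeff_modByMonic {N : ℕ} (x : Fin N → R) (P : R[X]) (i : Fin N) :
    P.eval (x i) = ∑ k : Fin N, x i ^ (k : ℕ) * (P %ₘ rootPoly x).coeff k := by
  nontriviality R
  have h0 : (rootPoly x).eval (x i) = 0 := by
    rw [rootPoly, eval_prod]
    exact Finset.prod_eq_zero (Finset.mem_univ i) (by simp)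
  conv_lhs => rw [← modByMonic_add_div P (rootPoly x)]
  rw [eval_add, eval_mul, h0, zero_mul, add_zero]
  have hN : 0 < N := i.pos
  rw [eval_eq_sum_range' (n := N)]
  · rw [Finset.sum_range]
    exact Finset.sum_congr rfl fun k _ => mul_comm _ _
  · exact natDegree_modByMonic_rootPoly_lt hN x P

-- Modulo `rootPoly x` the alternant factors as a Vandermonde matrix times a matrix of coefficients.
-- All columns but the first have degree below `N` and are unchanged, so the second factor is
-- triangular with a single diagonal entry not known to be `1`.
open Polynomial in
theorem alternant_oneRow {N : ℕ} (x y : Fin (N + 1) → R) (r : ℕ) :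
    alternant x y (rhoShift (oneRow (N + 1) r)) =
      ((Matrix.vandermonde x).submatrix id Fin.revPerm).det *
        (shiftedPowPoly y (r + N) %ₘ rootPoly x).coeff N := by
  nontriviality R
  let E : Fin (N + 1) → R[X] := fun j => shiftedPowPoly y (rhoShift (oneRow (N + 1) r) j)
  let L : Matrix (Fin (N + 1)) (Fin (N + 1)) R := Matrix.of fun i j =>
    (E j %ₘ rootPoly x).coeff (i.rev : ℕ)
  have hmul : alternant x y (rhoShift (oneRow (N + 1) r)) =
      ((Matrix.vandermonde x).submatrix id Fin.revPerm * L).det := by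
    unfold alternant
    congr 1
    ext i j
    rw [Matrix.of_apply, ← eval_shiftedPowPoly, eval_eq_sum_coeff_modByMonic, Matrix.mul_apply,
      ← Equiv.sum_comp Fin.revPerm]
    rfl
  have hE : ∀ j : Fin N, E j.succ %ₘ rootPoly x = shiftedPowPoly y (N - 1 - j) := by
    intro j
    have h1 : E j.succ = shiftedPowPoly y (N - 1 - j) := by
      simp only [E, rhoShift, oneRow]
      congr 1
      simp
      omega
    rw [h1, (modByMonic_eq_self_iff (monic_rootPoly x)).2]
    rw [degree_eq_natDegree (monic_rootPoly x).ne_zero,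
      degree_eq_natDegree (monic_shiftedPowPoly _ _).ne_zero, natDegree_rootPoly,
      natDegree_shiftedPowPoly]
    exact_mod_cast (by omega)
  have hL : L.BlockTriangular OrderDual.toDual := by
    intro i j hij
    have hij : i < j := hij
    obtain ⟨j, rfl⟩ := Fin.exists_succ_eq.2 (Fin.ne_zero_of_lt hij)
    simp only [L, Matrix.of_apply, hE]
    apply coeff_eq_zero_of_natDegree_lt
    rw [natDegree_shiftedPowPoly, Fin.val_rev]
    have h2 : (i : ℕ) < j + 1 := by simpa [Fin.lt_def] using hij
    have := j.2
    omega
  rw [hmul, Matrix.det_mul, Matrix.det_of_isLowerTriangular L hL, Fin.prod_univ_succ]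
  have h1 : ∀ j : Fin N, L j.succ j.succ = 1 := by
    intro j
    simp only [L, Matrix.of_apply, hE]
    have h2 := monic_shiftedPowPoly y (N - 1 - j)
    rw [Monic, leadingCoeff, natDegree_shiftedPowPoly] at h2
    rwa [show ((Fin.rev j.succ : Fin (N + 1)) : ℕ) = N - 1 - j by
      rw [Fin.val_rev, Fin.val_succ]; omega]
  have h0 : L 0 0 = (shiftedPowPoly y (r + N) %ₘ rootPoly x).coeff N := by
    simp [L, E, rhoShift, oneRow]
  simp [h1, h0]

open PowerSeries in
/-- The generating function `∏ (1 + y_i T) / (1 - x_i T)`. -/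
noncomputable def genSeries {N : ℕ} (x y : Fin N → R) : R⟦X⟧ :=
  ∏ i, (1 + C (y i) * X) * PowerSeries.mk fun n => x i ^ n

open PowerSeries in
theorem mk_pow_mul (x : R) : (PowerSeries.mk fun n => x ^ n) * (1 - C x * X) = 1 := by
  ext n
  rcases n with _ | n
  · simp
  · rw [mul_sub, mul_one, ← mul_assoc, map_sub, coeff_succ_mul_X, mul_comm _ (C x), coeff_C_mul]
    simp [pow_succ', coeff_one]

open PowerSeries in
theorem genSeries_mul {N : ℕ} (x y : Fin N → R) :
    genSeries x y * ∏ i, (1 - C (x i) * X) = ∏ i, (1 + C (y i) * X) := by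
  rw [genSeries, ← Finset.prod_mul_distrib]
  refine Finset.prod_congr rfl fun i _ => ?_
  rw [mul_assoc, mk_pow_mul, mul_one]

open Polynomial in
theorem reflect_prod_X_add_C {N : ℕ} (a : Fin N → R) :
    (∏ i, (X + C (a i))).reflect N = ∏ i, (1 + C (a i) * X) ∧ (∏ i, (X + C (a i))).natDegree ≤ N := by
  nontriviality R
  induction N with
  | zero => simp
  | succ N ih =>
    obtain ⟨h1, h2⟩ := ih fun i => a i.castSucc
    have h3 : (X + C (a (Fin.last N))).natDegree ≤ 1 := (natDegree_X_add_C _).le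
    rw [Fin.prod_univ_castSucc, Fin.prod_univ_castSucc, reflect_mul _ _ h2 h3, h1, reflect_add,
      reflect_one_X, reflect_C, pow_one]
    exact ⟨rfl, natDegree_mul_le.trans (add_le_add h2 h3)⟩

open PowerSeries in
theorem coeff_zero_genSeries {N : ℕ} (x y : Fin N → R) : coeff 0 (genSeries x y) = 1 := by
  rw [coeff_zero_eq_constantCoeff_apply, genSeries, map_prod]
  refine Finset.prod_eq_one fun i _ => ?_
  rw [map_mul, ← coeff_zero_eq_constantCoeff_apply (PowerSeries.mk _), coeff_mk]
  simp

-- Reversing the coefficients in `P = Q D + S` gives `∏ (1 + y_i T) = ∏ (1 - x_i T) D* + T^(r+1) S*`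
-- for index `r + 1`. After division by `∏ (1 - x_i T)`, `D*` has degree at most `r` and does not
-- reach `T^(r+1)`, whose coefficient is the constant term of `S*`.
open Polynomial in
theorem coeff_modByMonic_eq_coeff_genSeries {N : ℕ} (x y : Fin (N + 1) → R) (r : ℕ) :
    (shiftedPowPoly y (r + N) %ₘ rootPoly x).coeff N = PowerSeries.coeff r (genSeries x y) := by
  nontriviality R
  rcases r with _ | r
  -- Index `0` is separate: only `N` of the `N + 1` variables `y` occur, but the polynomial is
  -- already reduced and monic of degree `N`.
  · rw [coeff_zero_genSeries, zero_add, (modByMonic_eq_self_iff (monic_rootPoly x)).2]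
    · have := monic_shiftedPowPoly y N
      rwa [Monic, leadingCoeff, natDegree_shiftedPowPoly] at this
    · rw [degree_eq_natDegree (monic_rootPoly x).ne_zero,
        degree_eq_natDegree (monic_shiftedPowPoly _ _).ne_zero, natDegree_rootPoly,
        natDegree_shiftedPowPoly]
      exact_mod_cast Nat.lt_succ_self N
  · set P := shiftedPowPoly y (r + 1 + N) with hP
    set S := P %ₘ rootPoly x with hS
    set D := P /ₘ rootPoly x with hD
    have hSdeg : S.natDegree ≤ N :=
      Nat.lt_succ_iff.1 (natDegree_modByMonic_rootPoly_lt N.succ_pos x P)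
    have hDdeg : D.natDegree ≤ r := by
      rw [hD, natDegree_divByMonic _ (monic_rootPoly x), natDegree_rootPoly, hP,
        natDegree_shiftedPowPoly]
      omega
    have hroot : rootPoly x = ∏ i, (X + C (-x i)) := by
      simp [rootPoly, sub_eq_add_neg]
    have hQ := reflect_prod_X_add_C fun i => -x i
    rw [← hroot] at hQ
    have hY := reflect_prod_X_add_C y
    have hPr : P.reflect (r + (N + 1)) = ∏ i, (1 + C (y i) * X) := by
      rw [hP, show r + 1 + N = N + 1 + r by omega, shiftedPowPoly_add,
        reflect_mul _ _ (natDegree_X_pow_le r) hY.2, hY.1, reflect_monomial, revAt_le le_rfl,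
        Nat.sub_self, pow_zero, one_mul]
    have hSr : S.reflect (r + (N + 1)) = X ^ (r + 1) * S.reflect N := by
      rw [← reflect_one, ← reflect_mul _ _ (by simp) hSdeg, one_mul]
      congr 1
      omega
    have hQr : (rootPoly x * D).reflect (r + (N + 1)) =
        (∏ i, (1 + C (-x i) * X)) * D.reflect r := by
      rw [add_comm r, reflect_mul _ _ hQ.2 hDdeg, hQ.1]
    have key : ∏ i, (1 + C (y i) * X) =
        X ^ (r + 1) * S.reflect N + (∏ i, (1 + C (-x i) * X)) * D.reflect r := by
      rw [← hPr, ← hSr, ← hQr, ← reflect_add, hS, hD, modByMonic_add_div]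
    have key' := congrArg (coeToPowerSeries.ringHom (R := R)) key
    simp only [map_prod, map_add, map_mul, map_pow, coeToPowerSeries.ringHom_apply, coe_one, coe_C,
      coe_X, map_neg, neg_mul, ← sub_eq_add_neg, coe_sub, coe_mul] at key'
    rw [← genSeries_mul x y] at key'
    set V : PowerSeries R := ∏ i, PowerSeries.mk fun n => x i ^ n with hV
    have hV1 : V * ∏ i, (1 - PowerSeries.C (x i) * PowerSeries.X) = 1 := by
      rw [hV, ← Finset.prod_mul_distrib]
      exact Finset.prod_eq_one fun i _ => mk_pow_mul _
    have hV0 : PowerSeries.constantCoeff V = 1 := by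
      rw [hV, map_prod]
      refine Finset.prod_eq_one fun i _ => ?_
      rw [← PowerSeries.coeff_zero_eq_constantCoeff_apply, PowerSeries.coeff_mk, pow_zero]
    have hG : genSeries x y =
        PowerSeries.X ^ (r + 1) * (((S.reflect N : R[X]) : PowerSeries R) * V) +
          ((D.reflect r : R[X]) : PowerSeries R) := by
      linear_combination V * key' + (D.reflect r - genSeries x y) * hV1
    rw [hG, map_add, PowerSeries.coeff_X_pow_mul', if_pos le_rfl, Nat.sub_self,
      PowerSeries.coeff_zero_eq_constantCoeff_apply, map_mul, hV0, mul_one, coeff_coe,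
      coeff_eq_zero_of_natDegree_lt (p := D.reflect r), add_zero,
      ← PowerSeries.coeff_zero_eq_constantCoeff_apply, coeff_coe, coeff_reflect, revAt_zero]
    exact natDegree_reflect_le.trans_lt (by omega)

theorem genSeries_map {S : Type*} [CommRing S] (f : R →+* S) {N : ℕ} (x y : Fin N → R) :
    genSeries (fun i => f (x i)) (fun i => f (y i)) = PowerSeries.map f (genSeries x y) := by
  simp only [genSeries, map_prod, map_mul, map_add, map_one, PowerSeries.map_C, PowerSeries.map_X]
  refine Finset.prod_congr rfl fun i _ => ?_
  congr 1
  ext n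
  simp

/-- The denominator is the case `r = 0` of the same formula, so both alternants share the
Vandermonde factor, which cancels in the integral domain `ℤ[x, y]`. -/
theorem superSchurPoly_oneRow (N r : ℕ) :
    superSchurPoly (N + 1) (oneRow (N + 1) r) = PowerSeries.coeff r
      (genSeries (fun i => (MvPolynomial.X (Sum.inl i) : MvPolynomial (Fin (N + 1) ⊕ Fin (N + 1)) ℤ))
        fun i => MvPolynomial.X (Sum.inr i)) := by
  have hspec := Classical.choose_spec (alternant_rho_dvd
    (fun i => (MvPolynomial.X (Sum.inl i) : MvPolynomial (Fin (N + 1) ⊕ Fin (N + 1)) ℤ))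
    (fun i => MvPolynomial.X (Sum.inr i)) (rhoShift (oneRow (N + 1) r)))
  change _ = _ * superSchurPoly (N + 1) (oneRow (N + 1) r) at hspec
  have h0 : (0 : Fin (N + 1) → ℕ) = oneRow (N + 1) 0 := by
    funext i
    simp [oneRow]
  rw [h0, alternant_oneRow, alternant_oneRow, coeff_modByMonic_eq_coeff_genSeries,
    coeff_modByMonic_eq_coeff_genSeries, coeff_zero_genSeries, mul_one] at hspec
  refine (mul_left_cancel₀ ?_ hspec).symm
  rw [Matrix.det_permute']
  refine mul_ne_zero ?_ (Matrix.det_vandermonde_ne_zero_iff.2 fun i j hij => ?_)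
  · rcases Int.units_eq_one_or (Equiv.Perm.sign (Fin.revPerm (n := N + 1))) with h | h <;>
      simp [h]
  · simpa using MvPolynomial.X_injective hij

theorem superH_natCast {N : ℕ} (x y : Fin (N + 1) → R) (r : ℕ) :
    superH x y r = PowerSeries.coeff r (genSeries x y) := by
  rw [superH, if_pos (by positivity), Int.toNat_natCast, superSchurPoly_oneRow]
  have := genSeries_map (MvPolynomial.aeval (Sum.elim x y) :
    MvPolynomial (Fin (N + 1) ⊕ Fin (N + 1)) ℤ →ₐ[ℤ] R).toRingHom
    (fun i => MvPolynomial.X (Sum.inl i)) fun i => MvPolynomial.X (Sum.inr i)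
  simp at this
  rw [this]
  simp

/-! ### Toeplitz matrices -/

/-- The lower triangular Toeplitz matrix of a power series. -/
noncomputable def toeplitz (n : ℕ) (f : PowerSeries R) : Matrix (Fin n) (Fin n) R :=
  Matrix.of fun i j => if j ≤ i then PowerSeries.coeff ((i : ℕ) - j) f else 0

theorem toeplitz_one (n : ℕ) : toeplitz n (1 : PowerSeries R) = 1 := by
  ext i j
  simp only [toeplitz, Matrix.of_apply, PowerSeries.coeff_one, Matrix.one_apply]
  split_ifs <;> first | rfl | omega

/-- Truncation to size `n` loses nothing: by triangularity only the indices `j ≤ k ≤ i` contribute.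
-/
theorem toeplitz_mul (n : ℕ) (f g : PowerSeries R) :
    toeplitz n (f * g) = toeplitz n f * toeplitz n g := by
  ext i j
  simp only [toeplitz, Matrix.of_apply, Matrix.mul_apply, ite_zero_mul_ite_zero]
  rw [← Finset.sum_filter]
  split_ifs with h
  · rw [PowerSeries.coeff_mul]
    symm
    refine Finset.sum_bij (fun k _ => ((i : ℕ) - k, (k : ℕ) - j)) ?_ ?_ ?_ (fun _ _ => rfl)
    · intro k hk
      simp only [Finset.mem_filter, Fin.le_def] at hk
      rw [Finset.HasAntidiagonal.mem_antidiagonal]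
      omega
    · intro k hk k' hk' hkk
      simp only [Finset.mem_filter, Fin.le_def] at hk hk'
      simp only [Prod.mk.injEq] at hkk
      ext
      omega
    · rintro ⟨a, b⟩ hab
      rw [Finset.HasAntidiagonal.mem_antidiagonal] at hab
      have := i.2
      refine ⟨⟨j + b, by omega⟩, ?_, ?_⟩
      · simp only [Finset.mem_filter, Fin.le_def, Finset.mem_univ, true_and]
        have : (j : ℕ) ≤ i := h
        omega
      · have : (j : ℕ) ≤ i := h
        simp only [Prod.mk.injEq]
        omega
  · rw [Finset.filter_false_of_mem, Finset.sum_empty]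
    rintro k - ⟨h1, h2⟩
    exact h (h2.trans h1)

theorem toeplitz_prod {n N : ℕ} (f : Fin N → PowerSeries R) :
    (List.ofFn fun k => toeplitz n (f k)).prod = toeplitz n (∏ k, f k) := by
  induction N with
  | zero => simp [toeplitz_one]
  | succ N ih => rw [List.ofFn_succ, List.prod_cons, ih, Fin.prod_univ_succ, toeplitz_mul]

theorem toeplitz_transpose_prod {n N : ℕ} (f : Fin N → PowerSeries R) :
    (List.ofFn fun k => (toeplitz n (f k)).transpose).prod =
      (toeplitz n (∏ k, f k)).transpose := by
  induction N with
  | zero => simp [toeplitz_one]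
  | succ N ih =>
    rw [List.ofFn_succ, List.prod_cons, ih, Fin.prod_univ_succ, mul_comm, toeplitz_mul,
      Matrix.transpose_mul]

theorem toeplitz_apply_eq_hop {n : ℕ} (x y : R) (i j : Fin n) :
    toeplitz n ((1 + PowerSeries.C y * PowerSeries.X) * PowerSeries.mk fun n => x ^ n) i j =
      hop x y i j := by
  simp only [toeplitz, Matrix.of_apply]
  split_ifs with h
  · rcases h.eq_or_lt with rfl | h
    · rw [Nat.sub_self, hop_self, PowerSeries.coeff_zero_eq_constantCoeff_apply, map_mul,
        ← PowerSeries.coeff_zero_eq_constantCoeff_apply (PowerSeries.mk _), PowerSeries.coeff_mk]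
      simp
    · rw [hop_of_gt _ _ h]
      have h' : (j : ℕ) < i := h
      obtain ⟨d, hd⟩ : ∃ d, (i : ℕ) - j = d + 1 := ⟨i - j - 1, by omega⟩
      rw [hd, add_mul, one_mul, mul_assoc, mul_comm PowerSeries.X, ← mul_assoc, map_add,
        PowerSeries.coeff_succ_mul_X, PowerSeries.coeff_C_mul, PowerSeries.coeff_mk,
        PowerSeries.coeff_mk, Nat.add_sub_cancel]
      ring
  · exact (hop_of_lt _ _ (by simpa using h)).symm

theorem rectDet_transpose {l m : ℕ} (f : Fin l → Fin m → R) :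
    rectDet (fun j i => f i j) = rectDet f := by
  by_cases h : l = m
  · subst h
    rw [rectDet_self, rectDet_self, ← Matrix.det_transpose]
    rfl
  · rw [rectDet_of_ne h, rectDet_of_ne (Ne.symm h)]

/-! ### The two models -/

theorem rowFunction_flip {M : ℕ} (w : Spin → Spin → Spin → Spin → R)
    (b t : Fin (M + 1) → Spin) :
    rowFunction (fun a t c b => w a b c t) b t = rowFunction w t b := rfl

theorem weight_eq_gaugeWeight (x y A B : R) :
    weight x y A B = gaugeWeight x y A B (x + y) 1 := by
  funext a b c d
  cases a <;> cases b <;> cases c <;> cases d <;> simp [weight, gaugeWeight]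

theorem weightStar_eq_gaugeWeight (x y : R) (A B : Rˣ) :
    weightStar x y A B = fun a t c b =>
      gaugeWeight y x (A⁻¹ : Rˣ) (B⁻¹ : Rˣ) 1 (x + y) a b c t := by
  funext a b c d
  cases a <;> cases b <;> cases c <;> cases d <;> simp [weightStar, gaugeWeight]

theorem strictAnti_rhoShift {l : ℕ} {lam : Fin l → ℕ} (h : Antitone lam) :
    StrictAnti (rhoShift lam) := by
  intro i j hij
  have := h hij.le
  have h2 : (i : ℕ) < j := hij
  simp only [rhoShift]
  omega

/-- The columns of the parts of `lam + ρ`. -/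
def columns {l M : ℕ} (lam : Fin l → ℕ) (h : ∀ i, rhoShift lam i ≤ M) (i : Fin l) : Fin (M + 1) :=
  ⟨rhoShift lam i, Nat.lt_succ_of_le (h i)⟩

/-- The shift by `ρ` turns `lam_i - mu_j - i + j` into a difference of columns; negative indices are
the entries above the diagonal. -/
theorem skewSuperSchur_eq_det {N M l : ℕ} (lam mu : Fin l → ℕ)
    (hlam : ∀ i, rhoShift lam i ≤ M) (hmu : ∀ i, rhoShift mu i ≤ M) (x y : Fin (N + 1) → R) :
    skewSuperSchur lam mu x y = ((toeplitz (M + 1) (genSeries x y)).submatrix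
      (columns lam hlam) (columns mu hmu)).det := by
  unfold skewSuperSchur
  congr 1
  ext i j
  have hi := i.2
  have hj := j.2
  have he : (lam i : ℤ) - mu j - (i : ℕ) + (j : ℕ) = (rhoShift lam i : ℤ) - rhoShift mu j := by
    simp only [rhoShift]
    omega
  simp only [Matrix.of_apply, he, Matrix.submatrix_apply, toeplitz, columns, Fin.le_def]
  split_ifs with h
  · rw [← superH_natCast, Nat.cast_sub h]
  · rw [superH, if_neg (by omega)]

theorem Z_eq_skewSuperSchur {N M l : ℕ} (lam mu : Fin l → ℕ) (hlam : Antitone lam)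
    (hmu : Antitone mu) (hlamM : ∀ i, rhoShift lam i ≤ M) (hmuM : ∀ i, rhoShift mu i ≤ M)
    (x y A B : Fin (N + 1) → R) :
    Z M x y A B (rhoShift lam) (rhoShift mu) =
      (∏ i, A i ^ (M + 1) * B i ^ l) * skewSuperSchur lam mu x y := by
  rw [skewSuperSchur_eq_det lam mu hlamM hmuM, genSeries, ← toeplitz_prod]
  refine partitionFunction_eq_det _ (fun k l => A k ^ (M + 1) * B k ^ l) _ ?_ (columns lam hlamM)
    (columns mu hmuM) (strictAnti_rhoShift hlam) (strictAnti_rhoShift hmu)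
  intro k l m p q hp hq
  rw [weight_eq_gaugeWeight, rowFunction_gaugeWeight _ _ _ _ _ _ (mul_one _) p q hp hq]
  simp only [toeplitz_apply_eq_hop]

theorem ZStar_eq_skewSuperSchur {N M l : ℕ} (lam mu : Fin l → ℕ) (hlam : Antitone lam)
    (hmu : Antitone mu) (hlamM : ∀ i, rhoShift lam i ≤ M) (hmuM : ∀ i, rhoShift mu i ≤ M)
    (x y : Fin (N + 1) → R) (A B : Fin (N + 1) → Rˣ) :
    ZStar M x y A B (rhoShift lam) (rhoShift mu) =
      ((∏ i, A i ^ (-((M : ℤ) + 1)) * B i ^ (-(l : ℤ)) : Rˣ) : R) *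
        skewSuperSchur lam mu y x := by
  -- The rows are labelled from the top, but the factors of the series commute.
  have hg : genSeries y x = ∏ k : Fin (N + 1), (1 + PowerSeries.C (x k.rev) * PowerSeries.X) *
      PowerSeries.mk fun n => y k.rev ^ n :=
    (Equiv.prod_comp Fin.revPerm fun i => (1 + PowerSeries.C (x i) * PowerSeries.X) *
      PowerSeries.mk fun n => y i ^ n).symm
  rw [skewSuperSchur_eq_det lam mu hlamM hmuM, hg, ← Matrix.det_transpose,
    Matrix.transpose_submatrix, ← toeplitz_transpose_prod, ← Equiv.prod_comp Fin.revPerm,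
    Units.coe_prod]
  refine partitionFunction_eq_det _ (fun k l => ((A k.rev ^ (-((M : ℤ) + 1)) *
    B k.rev ^ (-(l : ℤ)) : Rˣ) : R)) _ ?_ (columns mu hmuM)
    (columns lam hlamM) (strictAnti_rhoShift hmu) (strictAnti_rhoShift hlam)
  intro k l m p q hp hq
  rw [weightStar_eq_gaugeWeight, rowFunction_flip,
    rowFunction_gaugeWeight _ _ _ _ _ _ (by ring) q p hq hp, ← rectDet_transpose]
  simp only [Matrix.transpose_apply, toeplitz_apply_eq_hop]
  -- After the flip the exponent of `B` counts the particles on the other boundary; the two counts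
  -- agree whenever the determinant is not `0` by convention.
  by_cases h : l = m
  · subst h
    congr 1
    rw [zpow_neg, zpow_neg, ← inv_zpow, ← inv_zpow, zpow_natCast, ← Nat.cast_succ, zpow_natCast]
    push_cast
    rfl
  · rw [rectDet_of_ne h, mul_zero, mul_zero]

end SixVertex

theorem mainTheorem4 {R : Type*} [CommRing R] (N M l : ℕ) (hN : 1 ≤ N)
    (lam mu : Fin l → ℕ) (hlam : Antitone lam) (hmu : Antitone mu)
    (hlamM : ∀ i, SixVertex.rhoShift lam i ≤ M) (hmuM : ∀ i, SixVertex.rhoShift mu i ≤ M)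
    (x y : Fin N → R) :
    (∀ A B : Fin N → R,
      SixVertex.Z M x y A B (SixVertex.rhoShift lam) (SixVertex.rhoShift mu) =
        (∏ i, A i ^ (M + 1) * B i ^ l) * SixVertex.skewSuperSchur lam mu x y) ∧
    (∀ A B : Fin N → Rˣ,
      SixVertex.ZStar M x y A B (SixVertex.rhoShift lam) (SixVertex.rhoShift mu) =
        ((∏ i, A i ^ (-((M : ℤ) + 1)) * B i ^ (-(l : ℤ)) : Rˣ) : R) *
          SixVertex.skewSuperSchur lam mu y x) := by
  -- With no variables the padded row is empty and forgets `r`, so the quotient of alternants would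
  -- be `1` for every `r`.
  obtain ⟨N, rfl⟩ := Nat.exists_eq_add_of_le' hN
  exact ⟨fun A B => SixVertex.Z_eq_skewSuperSchur lam mu hlam hmu hlamM hmuM x y A B,
    fun A B => SixVertex.ZStar_eq_skewSuperSchur lam mu hlam hmu hlamM hmuM x y A B⟩
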